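/- For $n \ge 2$ let $B_n$ be Artin's braid group, generated by $\sigma_1,\dots,\sigma_{n-1}$ subject to the relations $\sigma_i\sigma_j=\sigma_j\sigma_i$ for $|i-j|\ge 2$ and $\sigma_i\sigma_{i+1}\sigma_i=\sigma_{i+1}\sigma_i\sigma_{i+1}$ for $1\le i\le n-2$. A half-twist in $B_n$ is an element of the conjugacy class $\{q^{-1}\sigma_1 q : q\in B_n\}$ of $\sigma_1$. Theorem 2.11. Let $n\ge 2$, let $H_1,H_2\in B_n$ be half-twists, and suppose that $H_1^m=H_2^m$ for some integer $m\ge 1$. Then $H_1=H_2$. In contrast, roots are not unique among arbitrary braids: in $B_4$ there are elements $a\neq b$ with $a^2=b^2$. -/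

import Mathlib

/-- The defining relators of Artin's braid group on `n` strings. The generators are indexed by
`Fin (n - 1)`, so that `i : Fin (n - 1)` stands for the generator usually written `σ_{i+1}`. -/
def braidRels (n : ℕ) : Set (FreeGroup (Fin (n - 1))) :=
  {r | (∃ i j : Fin (n - 1), (i : ℕ) + 2 ≤ j ∧
          r = FreeGroup.of i * FreeGroup.of j * (FreeGroup.of j * FreeGroup.of i)⁻¹) ∨
       (∃ i j : Fin (n - 1), (i : ℕ) + 1 = j ∧
          r = FreeGroup.of i * FreeGroup.of j * FreeGroup.of i *
            (FreeGroup.of j * FreeGroup.of i * FreeGroup.of j)⁻¹)}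

/-- Artin's braid group `B_n`, given by generators and relations. -/
abbrev BraidGroup (n : ℕ) : Type := PresentedGroup (braidRels n)

/-- The standard generator of `B_n` with (zero-based) index `i`; `braidGen n 0` is `σ₁`. -/
def braidGen (n : ℕ) (i : Fin (n - 1)) : BraidGroup n := PresentedGroup.of i

/-- The set of half-twists in `B_n` (`n ≥ 2`): the conjugacy class `{q⁻¹ σ₁ q : q ∈ B_n}`. -/
def halfTwists (n : ℕ) (hn : 2 ≤ n) : Set (BraidGroup n) :=
  {β | ∃ q : BraidGroup n, β = q⁻¹ * braidGen n ⟨0, by omega⟩ * q}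

/-! Write the half-twists as conjugates of `σ₁` by `q₁` and `q₂`. Then `H₁ ^ m = H₂ ^ m` says that
`q₁ * q₂⁻¹` commutes with `σ₁ ^ m`, and the claim is that it commutes with `σ₁`
(`braidGen_commute_of_pow`). The full twist is central and every generator divides it, so a power of
it makes any braid positive. Positive braids embed in the braid group
(`positiveBraidHom_injective`), which leaves an equation `σ_i ^ m * p = p * σ_j ^ m` in the positive
monoid. `gen_mul_eq_mul_gen_of_pow` removes the exponent by stripping letters from the left of `p`.
Both this and the embedding rest on Garside's lemma `lcmMultiple_of_gen_mul_eq`, which gives left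
cancellation and controls divisibility. In `B_4`, a non-central element with central square has
several conjugates with the same square. -/

/-- The strings `i` and `j` index generators that satisfy the braid relation. -/
def BraidAdjacent {k : ℕ} (i j : Fin k) : Prop := (i : ℕ) + 1 = j ∨ (j : ℕ) + 1 = i

/-- The strings `i` and `j` index generators that are distinct and commute. -/
def BraidFar {k : ℕ} (i j : Fin k) : Prop := (i : ℕ) + 2 ≤ j ∨ (j : ℕ) + 2 ≤ i

/-- The defining relations of the positive braid monoid. -/
inductive PosBraidRel (k : ℕ) : FreeMonoid (Fin k) → FreeMonoid (Fin k) → Prop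
  | far (i j : Fin k) (h : BraidFar i j) :
      PosBraidRel k (.of i * .of j) (.of j * .of i)
  | adjacent (i j : Fin k) (h : BraidAdjacent i j) :
      PosBraidRel k (.of i * (.of j * .of i)) (.of j * (.of i * .of j))

/-- The monoid of positive braids with `k` generators. -/
abbrev PosBraid (k : ℕ) : Type := PresentedMonoid (PosBraidRel k)

/-! ### The positive braid monoid and its length function. -/

namespace PosBraid

variable {k : ℕ}

theorem far_symm {i j : Fin k} (h : BraidFar i j) : BraidFar j i := Or.symm h

theorem adjacent_symm {i j : Fin k} (h : BraidAdjacent i j) : BraidAdjacent j i := Or.symm h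

theorem trichotomy (i j : Fin k) : i = j ∨ BraidFar i j ∨ BraidAdjacent i j := by
  simp only [BraidFar, BraidAdjacent, Fin.ext_iff]; omega

theorem far_of_adjacent_adjacent {a g b : Fin k} (h : BraidAdjacent a g) (h' : BraidAdjacent g b)
    (hab : a ≠ b) : BraidFar a b := by
  simp only [BraidFar, BraidAdjacent, ne_eq, Fin.ext_iff] at *; omega

/-- The generators of the positive braid monoid. -/
def gen (i : Fin k) : PosBraid k := PresentedMonoid.of _ i

theorem gen_far {i j : Fin k} (h : BraidFar i j) : gen i * gen j = gen j * gen i :=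
  PresentedMonoid.mk_eq_mk_of_rel (.far i j h)

theorem gen_adjacent {i j : Fin k} (h : BraidAdjacent i j) :
    gen i * (gen j * gen i) = gen j * (gen i * gen j) :=
  PresentedMonoid.mk_eq_mk_of_rel (.adjacent i j h)

theorem gen_far_mul {i j : Fin k} (h : BraidFar i j) (x : PosBraid k) :
    gen i * (gen j * x) = gen j * (gen i * x) := by
  rw [← mul_assoc, gen_far h, mul_assoc]

theorem gen_adjacent_mul {i j : Fin k} (h : BraidAdjacent i j) (x : PosBraid k) :
    gen i * (gen j * (gen i * x)) = gen j * (gen i * (gen j * x)) := by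
  simpa only [mul_assoc] using congrArg (· * x) (gen_adjacent h)

/-- The word length, as a homomorphism. -/
def lengthHom (k : ℕ) : PosBraid k →* Multiplicative ℕ :=
  PresentedMonoid.lift (fun _ => Multiplicative.ofAdd 1) (by
    rintro _ _ (⟨i, j, h⟩ | ⟨i, j, h⟩) <;> rfl)

/-- The length of a positive braid. -/
def len (x : PosBraid k) : ℕ := (lengthHom k x).toAdd

@[simp] theorem len_mul (x y : PosBraid k) : len (x * y) = len x + len y := by simp [len]

@[simp] theorem len_one : len (1 : PosBraid k) = 0 := by simp [len]

@[simp] theorem len_gen (i : Fin k) : len (gen i) = 1 := rfl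

theorem mk_of_mul (i : Fin k) (w : FreeMonoid (Fin k)) :
    PresentedMonoid.mk (PosBraidRel k) (.of i * w) = gen i * PresentedMonoid.mk _ w := rfl

theorem eq_one_or_gen_mul (x : PosBraid k) : x = 1 ∨ ∃ i y, x = gen i * y := by
  obtain ⟨w, rfl⟩ := PresentedMonoid.surjective_mk x
  cases w with
  | one => exact .inl rfl
  | of_mul i w => exact .inr ⟨i, _, mk_of_mul i w⟩

/-! ### Garside's lemma and left cancellation. -/

/-- `gen i * x` and `gen j * y` are the same multiple of the least common right multiple of
`gen i` and `gen j`. -/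
inductive LcmMultiple : Fin k → Fin k → PosBraid k → PosBraid k → Prop
  | same (i x) : LcmMultiple i i x x
  | far {i j} (h : BraidFar i j) (w) : LcmMultiple i j (gen j * w) (gen i * w)
  | adjacent {i j} (h : BraidAdjacent i j) (w) :
      LcmMultiple i j (gen j * (gen i * w)) (gen i * (gen j * w))

namespace LcmMultiple

theorem symm {i j : Fin k} {x y : PosBraid k} (h : LcmMultiple i j x y) :
    LcmMultiple j i y x := by
  cases h with
  | same => exact .same _ _
  | far h w => exact .far (far_symm h) w
  | adjacent h w => exact .adjacent (adjacent_symm h) w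

theorem mul_right {i j : Fin k} {x y : PosBraid k} (h : LcmMultiple i j x y) (u : PosBraid k) :
    LcmMultiple i j (x * u) (y * u) := by
  cases h with
  | same => exact .same _ _
  | far h w => simpa only [mul_assoc] using far h (w * u)
  | adjacent h w => simpa only [mul_assoc] using adjacent h (w * u)

theorem eq {i : Fin k} {x y : PosBraid k} (h : LcmMultiple i i x y) : x = y := by
  cases h with
  | same => rfl
  | far h => simp [BraidFar] at h
  | adjacent h => simp [BraidAdjacent] at h

theorem of_far {i j : Fin k} (hij : BraidFar i j) {x y : PosBraid k} (h : LcmMultiple i j x y) :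
    ∃ w, x = gen j * w ∧ y = gen i * w := by
  cases h with
  | same => simp [BraidFar] at hij
  | far h w => exact ⟨w, rfl, rfl⟩
  | adjacent h => simp only [BraidFar, BraidAdjacent] at *; omega

theorem of_adjacent {i j : Fin k} (hij : BraidAdjacent i j) {x y : PosBraid k}
    (h : LcmMultiple i j x y) :
    ∃ w, x = gen j * (gen i * w) ∧ y = gen i * (gen j * w) := by
  cases h with
  | same => simp [BraidAdjacent] at hij
  | adjacent h w => exact ⟨w, rfl, rfl⟩
  | far h => simp only [BraidFar, BraidAdjacent] at *; omega

/-- The mixed case of `trans`: the middle braid is `gen a * X`, and `ih` resolves its two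
factorizations down to a common remainder. -/
theorem trans_far_adjacent {N : ℕ}
    (ih : ∀ (i j : Fin k) (x y : PosBraid k), len x < N → gen i * x = gen j * y →
      LcmMultiple i j x y)
    {a g b : Fin k} (hag : BraidFar a g) (hgb : BraidAdjacent g b) {X Y : PosBraid k}
    (hN : len X < N) (hX : gen a * X = gen b * (gen g * Y)) :
    LcmMultiple a b (gen g * X) (gen g * (gen b * Y)) := by
  have hl := congrArg len hX
  simp only [len_mul, len_gen] at hl
  have h := ih _ _ _ _ hN hX
  rcases trichotomy a b with rfl | hab | hab
  · simp only [BraidFar, BraidAdjacent] at *; omega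
  · obtain ⟨Z, rfl, h2⟩ := h.of_far hab
    obtain ⟨T, rfl, rfl⟩ := (ih _ _ _ _ (by omega) h2).of_far (far_symm hag)
    convert far hab (gen g * (gen b * T)) using 1
    · exact gen_adjacent_mul hgb _
    · rw [← gen_far_mul hab, ← gen_far_mul hag]
  · obtain ⟨Z, rfl, h2⟩ := h.of_adjacent hab
    simp only [len_mul, len_gen] at hl hN
    obtain ⟨T, rfl, h3⟩ := (ih _ _ _ _ (by omega) h2).of_far (far_symm hag)
    obtain ⟨R, rfl, rfl⟩ := (ih _ _ _ _ (by omega) h3).of_adjacent (adjacent_symm hgb)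
    convert adjacent hab (gen g * (gen b * (gen a * R))) using 1
    · rw [gen_far_mul hag, gen_adjacent_mul hgb, ← gen_adjacent_mul hab,
        gen_far_mul (far_symm hag)]
    · rw [← gen_adjacent_mul hgb, gen_adjacent_mul (adjacent_symm hab),
        gen_far_mul (far_symm hag) (gen b * _), gen_far_mul (far_symm hag) R]

theorem trans {N : ℕ}
    (ih : ∀ (i j : Fin k) (x y : PosBraid k), len x < N → gen i * x = gen j * y →
      LcmMultiple i j x y)
    {a g b : Fin k} {x y w : PosBraid k} (hN : len w ≤ N) (h₁ : LcmMultiple a g x w)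
    (h₂ : LcmMultiple g b w y) : LcmMultiple a b x y := by
  have cancel (i : Fin k) (x y : PosBraid k) (h : len x < N) (e : gen i * x = gen i * y) : x = y :=
    (ih _ _ _ _ h e).eq
  generalize hw : w = w' at h₂
  cases h₁ with
  | same => exact hw ▸ h₂
  | far hag X =>
    simp only [len_mul, len_gen] at hN
    cases h₂ with
    | same => exact hw ▸ .far hag X
    | far hgb Y =>
      obtain h := ih _ _ _ _ (by omega) hw
      cases h with
      | same => exact .same _ _
      | far hab Z => rw [gen_far_mul hgb, gen_far_mul (far_symm hag)]; exact .far hab _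
      | adjacent hab Z =>
        rw [gen_far_mul hgb, gen_far_mul (far_symm hag), gen_far_mul (far_symm hag),
          gen_far_mul hgb]
        exact .adjacent hab _
    | adjacent hgb Y => exact trans_far_adjacent ih hag hgb (by omega) hw
  | adjacent hag X =>
    simp only [len_mul, len_gen] at hN
    have hl := congrArg len hw
    cases h₂ with
    | same => exact hw ▸ .adjacent hag X
    | far hgb Y =>
      simp only [len_mul, len_gen] at hl
      exact (trans_far_adjacent ih (far_symm hgb) (adjacent_symm hag) (by omega) hw.symm).symm
    | adjacent hgb Y =>
      simp only [len_mul, len_gen] at hl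
      by_cases e : a = b
      · subst e
        have h1 := cancel _ _ _ (by simp; omega) hw
        rw [cancel _ _ _ (by omega) h1]
        exact .same _ _
      · have hab := far_of_adjacent_adjacent hag hgb e
        obtain ⟨Z, h1, h2⟩ := (ih _ _ _ _ (by simp; omega) hw).of_far hab
        have hl1 := congrArg len h1
        simp only [len_mul, len_gen] at hl1
        obtain ⟨T, rfl, rfl⟩ := (ih _ _ _ _ (by omega) h1).of_adjacent hgb
        obtain ⟨S, rfl, h4⟩ := (ih _ _ _ _ (by omega) h2).of_adjacent (adjacent_symm hag)
        simp only [len_mul, len_gen] at hl hl1 hN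
        have h5 := cancel _ _ _ (by simp; omega) h4
        obtain ⟨R, rfl, rfl⟩ := (ih _ _ _ _ (by omega) h5).of_far (far_symm hab)
        convert far hab (gen g * (gen b * (gen a * (gen g * R)))) using 1
        · rw [gen_far_mul hab, gen_adjacent_mul hag, gen_adjacent_mul hgb]
        · rw [gen_far_mul (far_symm hab), ← gen_adjacent_mul hgb,
            gen_adjacent_mul (adjacent_symm hag), gen_far_mul hab]

end LcmMultiple

theorem freeMonoid_cases (w : FreeMonoid (Fin k)) : w = 1 ∨ ∃ i u, w = .of i * u := by
  cases w with
  | one => exact .inl rfl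
  | of_mul i w => exact .inr ⟨i, w, rfl⟩

theorem of_mul_inj {i j : Fin k} {u v : FreeMonoid (Fin k)}
    (h : FreeMonoid.of i * u = .of j * v) : i = j ∧ u = v :=
  List.cons.inj h

theorem mk_eq_of_rel {w w' : FreeMonoid (Fin k)} (h : ConGen.Rel (PosBraidRel k) w w') :
    PresentedMonoid.mk (PosBraidRel k) w = PresentedMonoid.mk _ w' :=
  PresentedMonoid.mk_eq_mk_iff.2 h

theorem eq_one_of_mk_eq_one {w : FreeMonoid (Fin k)}
    (h : PresentedMonoid.mk (PosBraidRel k) w = 1) : w = 1 := by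
  obtain rfl | ⟨i, u, rfl⟩ := freeMonoid_cases w
  · rfl
  · have := congrArg len h
    simp [mk_of_mul] at this

theorem exists_of_mul_of_rel {w' u : FreeMonoid (Fin k)} {i : Fin k}
    (h : ConGen.Rel (PosBraidRel k) (.of i * u) w') : ∃ j v, w' = .of j * v := by
  refine (freeMonoid_cases w').resolve_left ?_
  rintro rfl
  have := congrArg len (mk_eq_of_rel h)
  simp [mk_of_mul] at this

/-- Induction on the derivation of the congruence. Only transitivity is hard; there `ih`, Garside's
lemma for shorter braids, is applied to what follows the first letter of the intermediate word. -/
theorem lcmMultiple_of_rel {N : ℕ}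
    (ih : ∀ (i j : Fin k) (x y : PosBraid k), len x < N → gen i * x = gen j * y →
      LcmMultiple i j x y)
    {w w' : FreeMonoid (Fin k)} (h : ConGen.Rel (PosBraidRel k) w w')
    (hN : len (PresentedMonoid.mk (PosBraidRel k) w) ≤ N + 1) {i j : Fin k}
    {u v : FreeMonoid (Fin k)} (hw : w = .of i * u) (hw' : w' = .of j * v) :
    LcmMultiple i j (PresentedMonoid.mk _ u) (PresentedMonoid.mk _ v) := by
  induction h generalizing i j u v with
  | of x y h =>
    cases h with
    | far a b h =>
      obtain ⟨rfl, rfl⟩ := of_mul_inj hw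
      obtain ⟨rfl, rfl⟩ := of_mul_inj hw'
      simpa [gen, PresentedMonoid.of] using LcmMultiple.far h 1
    | adjacent a b h =>
      obtain ⟨rfl, rfl⟩ := of_mul_inj hw
      obtain ⟨rfl, rfl⟩ := of_mul_inj hw'
      simpa [gen, PresentedMonoid.of] using LcmMultiple.adjacent h 1
  | refl x =>
    obtain ⟨rfl, rfl⟩ := of_mul_inj (hw.symm.trans hw')
    exact .same _ _
  | symm h ih' => exact (ih' (mk_eq_of_rel h ▸ hN) hw' hw).symm
  | trans h₁ h₂ ih₁ ih₂ =>
    subst hw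
    obtain ⟨g, t, rfl⟩ := exists_of_mul_of_rel h₁
    rw [mk_eq_of_rel h₁] at hN
    refine LcmMultiple.trans ih ?_ (ih₁ (mk_eq_of_rel h₁ ▸ hN) rfl rfl) (ih₂ hN rfl hw')
    simp only [mk_of_mul, len_mul, len_gen] at hN
    omega
  | @mul w x y z h₁ h₂ ih₁ ih₂ =>
    simp only [map_mul, len_mul] at hN
    -- Length is invariant, so the left factors are both empty or both contain the first letters.
    obtain rfl | ⟨a, s, rfl⟩ := freeMonoid_cases w
    · obtain rfl := eq_one_of_mk_eq_one (mk_eq_of_rel h₁).symm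
      exact ih₂ (by omega) (by simpa using hw) (by simpa using hw')
    · obtain ⟨b, t, rfl⟩ := exists_of_mul_of_rel h₁
      rw [mul_assoc] at hw hw'
      obtain ⟨rfl, rfl⟩ := of_mul_inj hw
      obtain ⟨rfl, rfl⟩ := of_mul_inj hw'
      simp only [map_mul]
      rw [mk_eq_of_rel h₂]
      exact (ih₁ (by omega) rfl rfl).mul_right _

/-- Garside's lemma: a common right multiple of two generators is a multiple of their least
common right multiple. -/
theorem lcmMultiple_of_gen_mul_eq {i j : Fin k} {x y : PosBraid k}
    (h : gen i * x = gen j * y) : LcmMultiple i j x y := by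
  suffices H : ∀ N, ∀ (i j : Fin k) (x y : PosBraid k), len x < N → gen i * x = gen j * y →
      LcmMultiple i j x y from H (len x + 1) i j x y (by omega) h
  intro N
  induction N with
  | zero => intro _ _ _ _ h; omega
  | succ N ih =>
    intro i j x y hN h
    obtain ⟨u, rfl⟩ := PresentedMonoid.surjective_mk x
    obtain ⟨v, rfl⟩ := PresentedMonoid.surjective_mk y
    rw [← mk_of_mul, ← mk_of_mul] at h
    refine lcmMultiple_of_rel ih (PresentedMonoid.mk_eq_mk_iff.1 h) ?_ rfl rfl
    simp only [mk_of_mul, len_mul, len_gen]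
    omega

theorem gen_mul_cancel {i : Fin k} {x y : PosBraid k} (h : gen i * x = gen i * y) : x = y :=
  (lcmMultiple_of_gen_mul_eq h).eq

@[elab_as_elim]
theorem gen_induction {C : PosBraid k → Prop} (x : PosBraid k) (one : C 1)
    (gen_mul : ∀ i y, C y → C (gen i * y)) : C x := by
  obtain ⟨w, rfl⟩ := PresentedMonoid.surjective_mk x
  induction w using FreeMonoid.recOn with
  | one => exact one
  | of_mul i u ih => exact gen_mul i _ ih

instance : IsLeftCancelMul (PosBraid k) where
  mul_left_cancel a x y h := by
    induction a using gen_induction with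
    | one => simpa using h
    | gen_mul i a ih =>
      simp only [mul_assoc] at h
      exact ih (gen_mul_cancel h)

/-! ### Removing exponents from conjugation equations. -/

theorem gen_pow_far {i j : Fin k} (h : BraidFar i j) (m : ℕ) :
    gen i ^ m * gen j = gen j * gen i ^ m :=
  (show Commute (gen i) (gen j) from gen_far h).pow_left m

theorem gen_pow_adjacent {i j : Fin k} (h : BraidAdjacent i j) (m : ℕ) :
    gen i ^ m * (gen j * gen i) = gen j * (gen i * gen j ^ m) := by
  have : SemiconjBy (gen j * gen i) (gen j) (gen i) := by
    simpa only [SemiconjBy, mul_assoc] using (gen_adjacent h).symm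
  simpa only [SemiconjBy, mul_assoc] using (this.pow_right m).symm

/-- A multiple of `gen i ^ m` and of a commuting `gen j` is a multiple of their product. -/
theorem gen_dvd_of_far {i j : Fin k} (h : BraidFar i j) (m : ℕ) {x y : PosBraid k}
    (e : gen i ^ m * x = gen j * y) : ∃ z, x = gen j * z := by
  induction m generalizing y with
  | zero => exact ⟨y, by simpa using e⟩
  | succ m ih =>
    rw [pow_succ', mul_assoc] at e
    obtain ⟨w, hw, -⟩ := (lcmMultiple_of_gen_mul_eq e).of_far h
    exact ih hw

/-- Cancelling one `gen i` leaves a braid that again starts with `gen j`, so the argument repeats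
until a single `gen i` remains. -/
theorem gen_mul_gen_dvd_of_adjacent {i j : Fin k} (h : BraidAdjacent i j) (m : ℕ) (hm : 1 ≤ m)
    {x y : PosBraid k} (e : gen i ^ m * x = gen j * y) : ∃ z, x = gen j * (gen i * z) := by
  induction m, hm using Nat.le_induction generalizing y with
  | base =>
    rw [pow_one] at e
    obtain ⟨w, hw, -⟩ := (lcmMultiple_of_gen_mul_eq e).of_adjacent h
    exact ⟨w, hw⟩
  | succ m hm ih =>
    rw [pow_succ', mul_assoc] at e
    obtain ⟨w, hw, -⟩ := (lcmMultiple_of_gen_mul_eq e).of_adjacent h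
    exact ih hw

theorem eq_of_gen_pow_eq {i j : Fin k} {m : ℕ} (hm : 1 ≤ m) (h : gen i ^ m = gen j ^ m) :
    i = j := by
  obtain ⟨m, rfl⟩ := Nat.exists_eq_add_of_le' hm
  have e : gen i ^ (m + 1) * 1 = gen j * gen j ^ m := by rw [mul_one, h, pow_succ']
  rcases trichotomy i j with hij | hij | hij
  · exact hij
  · obtain ⟨z, hz⟩ := gen_dvd_of_far hij _ e
    have := congrArg len hz
    simp only [len_one, len_mul, len_gen] at this
    omega
  · obtain ⟨z, hz⟩ := gen_mul_gen_dvd_of_adjacent hij _ hm e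
    have := congrArg len hz
    simp only [len_one, len_mul, len_gen] at this
    omega

/-- A positive braid conjugating a power of a generator to a power of a generator conjugates the
generators themselves. -/
theorem gen_mul_eq_mul_gen_of_pow {m : ℕ} (hm : 1 ≤ m) {i j : Fin k} {p : PosBraid k}
    (h : gen i ^ m * p = p * gen j ^ m) : gen i * p = p * gen j := by
  induction hN : len p using Nat.strong_induction_on generalizing p i with
  | _ N ih =>
    obtain rfl | ⟨c, q, rfl⟩ := eq_one_or_gen_mul p
    · rw [mul_one, one_mul] at h
      rw [eq_of_gen_pow_eq hm h, mul_one, one_mul]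
    simp only [len_mul, len_gen] at hN
    rcases trichotomy i c with rfl | hic | hic
    · have : gen i ^ m * q = q * gen j ^ m := by
        apply mul_left_cancel (a := gen i)
        rw [← mul_assoc, ← mul_assoc, ← h, ← mul_assoc, (Commute.self_pow (gen i) m).eq]
      rw [mul_assoc, ← ih _ (by omega) this rfl]
    · have : gen i ^ m * q = q * gen j ^ m := by
        apply mul_left_cancel (a := gen c)
        rw [← mul_assoc, ← mul_assoc, ← h, ← mul_assoc, gen_pow_far hic]
      rw [mul_assoc, ← ih _ (by omega) this rfl, gen_far_mul hic]
    -- Here `p = gen c * gen i * z`. Moving the power past `gen c * gen i` turns `gen i` into `gen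
    -- c`, so the induction must allow `i` to vary.
    · obtain ⟨z, hz⟩ := gen_mul_gen_dvd_of_adjacent hic m hm (h.trans (mul_assoc _ _ _))
      obtain rfl := mul_left_cancel hz
      simp only [len_mul, len_gen] at hN
      have : gen c ^ m * z = z * gen j ^ m := by
        apply mul_left_cancel (a := gen c * gen i)
        calc _ = gen c * (gen i * gen c ^ m) * z := by simp only [mul_assoc]
          _ = _ := by
            rw [← gen_pow_adjacent hic]
            simpa only [mul_assoc] using h
      rw [gen_adjacent_mul hic, ih _ (by omega) this rfl]
      simp only [mul_assoc]

/-! ### The full twist: centrality and divisibility. -/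

/-- The generator with index `i`, or `1` if `i` is out of range. -/
def natGen (k i : ℕ) : PosBraid k := if h : i < k then gen ⟨i, h⟩ else 1

theorem natGen_val (i : Fin k) : natGen k i = gen i := by simp [natGen]

theorem natGen_commute {i j : ℕ} (h : i + 2 ≤ j) : Commute (natGen k i) (natGen k j) := by
  unfold natGen
  split_ifs
  · exact gen_far (.inl h)
  all_goals simp

theorem natGen_braid {i : ℕ} (h : i + 1 < k) :
    natGen k i * natGen k (i + 1) * natGen k i =
      natGen k (i + 1) * natGen k i * natGen k (i + 1) := by
  simp only [natGen, h, show i < k by omega, dite_true, mul_assoc]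
  exact gen_adjacent (.inl rfl)

/-- The product of the first `r` generators. -/
def cox (k : ℕ) : ℕ → PosBraid k
  | 0 => 1
  | r + 1 => cox k r * natGen k r

/-- The product of the `r` generators after the first one. -/
def coxShift (k : ℕ) : ℕ → PosBraid k
  | 0 => 1
  | r + 1 => coxShift k r * natGen k (r + 1)

theorem cox_succ_eq (r : ℕ) : cox k (r + 1) = natGen k 0 * coxShift k r := by
  induction r with
  | zero => simp [cox, coxShift]
  | succ r ih => rw [cox, ih, coxShift, mul_assoc]

theorem cox_commute {r j : ℕ} (h : r + 1 ≤ j) : Commute (cox k r) (natGen k j) := by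
  induction r with
  | zero => exact Commute.one_left _
  | succ r ih => exact (ih (by omega)).mul_left (natGen_commute (by omega))

theorem cox_semiconjBy {r i : ℕ} (hi : i + 1 < r) (hr : r ≤ k) :
    SemiconjBy (cox k r) (natGen k i) (natGen k (i + 1)) := by
  induction r with
  | zero => omega
  | succ r ih =>
    obtain h | rfl : i + 1 < r ∨ r = i + 1 := by omega
    · exact (ih h (by omega)).mul_left (natGen_commute (by omega)).symm
    · have h := (cox_commute (k := k) (r := i) (j := i + 1) le_rfl).eq
      rw [SemiconjBy, cox, cox]
      calc _ = cox k i * (natGen k i * natGen k (i + 1) * natGen k i) := by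
            simp only [mul_assoc]
        _ = cox k i * natGen k (i + 1) * (natGen k i * natGen k (i + 1)) := by
            rw [natGen_braid (by omega)]; simp only [mul_assoc]
        _ = _ := by rw [h]; simp only [mul_assoc]

theorem cox_semiconjBy_cox {r : ℕ} (hr : r + 1 ≤ k) :
    SemiconjBy (cox k k) (cox k r) (coxShift k r) := by
  induction r with
  | zero => exact SemiconjBy.one_right _
  | succ r ih => exact (ih (by omega)).mul_right (cox_semiconjBy (by omega) le_rfl)

/-- With `δ` the product of all generators, `δ = σ_0 * s = c * σ_m` and `δ * c = s * δ`; hence `δ² *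
σ_m = σ_0 * s * δ * σ_m = σ_0 * δ²`. -/
theorem cox_sq_semiconjBy (m : ℕ) :
    SemiconjBy (cox (m + 1) (m + 1) ^ 2) (natGen (m + 1) m) (natGen (m + 1) 0) := by
  have h := (cox_semiconjBy_cox (k := m + 1) (r := m) le_rfl).eq
  rw [SemiconjBy, sq]
  calc _ = natGen _ 0 * coxShift _ m * cox (m + 1) (m + 1) * natGen _ m := by
        rw [← cox_succ_eq]
    _ = natGen _ 0 * (cox (m + 1) (m + 1) * (cox _ m * natGen _ m)) := by
        rw [mul_assoc (natGen _ 0), ← h]; simp only [mul_assoc]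
    _ = _ := rfl

theorem cox_pow_semiconjBy {i r : ℕ} (h : i + r < k) :
    SemiconjBy (cox k k ^ r) (natGen k i) (natGen k (i + r)) := by
  induction r with
  | zero => simp
  | succ r ih =>
    rw [pow_succ']
    exact (cox_semiconjBy (i := i + r) (by omega) le_rfl).mul_left (ih (by omega))

/-- The full twist. -/
def fullTwist (k : ℕ) : PosBraid k := cox k k ^ (k + 1)

/-- Conjugation by `cox` cycles the generators: `m - i` steps to the last one, two to wrap round to
the first, `i` to return, `m + 2` in total. -/
theorem fullTwist_commute_gen (i : Fin k) : Commute (fullTwist k) (gen i) := by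
  obtain _ | m := k
  · exact i.elim0
  rw [← natGen_val]
  have h₁ := cox_pow_semiconjBy (k := m + 1) (i := i) (r := m - i) (by omega)
  have h₂ := cox_pow_semiconjBy (k := m + 1) (i := 0) (r := i) (by omega)
  rw [show (i : ℕ) + (m - i) = m by omega] at h₁
  rw [zero_add] at h₂
  have h := (h₂.mul_left (cox_sq_semiconjBy m)).mul_left h₁
  rwa [← pow_add, ← pow_add, show (i : ℕ) + 2 + (m - i) = m + 1 + 1 by omega] at h

theorem fullTwist_commute (x : PosBraid k) : Commute (fullTwist k) x := by
  induction x using gen_induction with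
  | one => exact Commute.one_right _
  | gen_mul i y ih => exact (fullTwist_commute_gen i).mul_right ih

/-- The first generator divides `cox`, and `cox ^ i` carries it to `gen i`. -/
theorem gen_dvd_fullTwist (i : Fin k) : ∃ y, gen i * y = fullTwist k := by
  obtain _ | m := k
  · exact i.elim0
  have h := (cox_pow_semiconjBy (k := m + 1) (i := 0) (r := i) (by omega)).eq
  rw [zero_add, natGen_val] at h
  refine ⟨cox _ (m + 1) ^ (i : ℕ) * coxShift _ m * cox _ (m + 1) ^ (m + 1 - i), ?_⟩
  rw [← mul_assoc, ← mul_assoc, ← h, mul_assoc (cox _ _ ^ (i : ℕ)), ← cox_succ_eq, ← pow_succ,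
    ← pow_add, fullTwist]
  congr 1
  omega

/-- The generator `gen i` has a two-sided complement in the full twist. -/
theorem exists_complement (i : Fin k) :
    ∃ y, gen i * y = fullTwist k ∧ y * gen i = fullTwist k := by
  obtain ⟨y, hy⟩ := gen_dvd_fullTwist i
  refine ⟨y, hy, gen_mul_cancel (i := i) ?_⟩
  rw [← mul_assoc, hy, (fullTwist_commute_gen i).eq]

/-! ### Fractions and the embedding into the braid group. -/

instance : OreLocalization.OreSet (Submonoid.powers (fullTwist k)) where
  ore_right_cancel r₁ r₂ s h := by
    obtain ⟨_, j, rfl⟩ := s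
    exact ⟨⟨_, j, rfl⟩, by
      simpa only [((fullTwist_commute _).pow_left j).eq] using h⟩
  oreNum r _ := r
  oreDenom _ s := s
  ore_eq r s := by
    obtain ⟨_, j, rfl⟩ := s
    exact ((fullTwist_commute r).pow_left j).eq

/-- The monoid of fractions of the positive braid monoid. -/
abbrev Frac (k : ℕ) : Type := OreLocalization (Submonoid.powers (fullTwist k)) (PosBraid k)

/-- The canonical map to the monoid of fractions. -/
def toFrac (k : ℕ) : PosBraid k →* Frac k := OreLocalization.numeratorHom

theorem toFrac_injective : Function.Injective (toFrac k) := by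
  intro x y h
  obtain ⟨u, v, h₁, h₂⟩ := OreLocalization.oreDiv_eq_iff.1 h
  simp only [OneMemClass.coe_one, mul_one] at h₂
  rw [← h₂] at h₁
  exact (mul_left_cancel h₁).symm

theorem isUnit_toFrac_gen (i : Fin k) : IsUnit (toFrac k (gen i)) := by
  obtain ⟨y, h₁, h₂⟩ := exists_complement i
  obtain ⟨u, hu⟩ : IsUnit (toFrac k (fullTwist k)) :=
    OreLocalization.numerator_isUnit ⟨fullTwist k, Submonoid.mem_powers _⟩
  refine isUnit_iff_exists_and_exists.2 ⟨⟨toFrac k y * ↑u⁻¹, ?_⟩, ⟨↑u⁻¹ * toFrac k y, ?_⟩⟩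
  · rw [← mul_assoc, ← map_mul, h₁, ← hu, Units.mul_inv]
  · rw [mul_assoc, ← map_mul, h₂, ← hu, Units.inv_mul]

end PosBraid

open PosBraid

theorem braidGen_commute {n : ℕ} {i j : Fin (n - 1)} (h : BraidFar i j) :
    braidGen n i * braidGen n j = braidGen n j * braidGen n i := by
  rcases h with h | h
  · exact mul_inv_eq_one.1 (PresentedGroup.one_of_mem (.inl ⟨i, j, h, rfl⟩))
  · exact (mul_inv_eq_one.1 (PresentedGroup.one_of_mem (.inl ⟨j, i, h, rfl⟩))).symm

theorem braidGen_braid {n : ℕ} {i j : Fin (n - 1)} (h : BraidAdjacent i j) :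
    braidGen n i * braidGen n j * braidGen n i = braidGen n j * braidGen n i * braidGen n j := by
  rcases h with h | h
  · exact mul_inv_eq_one.1 (PresentedGroup.one_of_mem (.inr ⟨i, j, h, rfl⟩))
  · exact (mul_inv_eq_one.1 (PresentedGroup.one_of_mem (.inr ⟨j, i, h, rfl⟩))).symm

/-- The canonical map from positive braids to braids. -/
def positiveBraidHom (n : ℕ) : PosBraid (n - 1) →* BraidGroup n :=
  PresentedMonoid.lift (braidGen n) (by
    rintro _ _ (⟨i, j, h⟩ | ⟨i, j, h⟩)
    · simpa using braidGen_commute h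
    · simpa [← mul_assoc] using braidGen_braid h)

@[simp] theorem positiveBraidHom_gen {n : ℕ} (i : Fin (n - 1)) :
    positiveBraidHom n (gen i) = braidGen n i := rfl

/-- The generators as units of the monoid of fractions. -/
noncomputable def fracUnit {k : ℕ} (i : Fin k) : (Frac k)ˣ := (isUnit_toFrac_gen i).unit

theorem val_fracUnit {k : ℕ} (i : Fin k) : (fracUnit i : Frac k) = toFrac k (gen i) :=
  (isUnit_toFrac_gen i).unit_spec

/-- The map from braids to fractions of positive braids. -/
noncomputable def braidToFrac (n : ℕ) : BraidGroup n →* (Frac (n - 1))ˣ :=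
  PresentedGroup.toGroup (f := fracUnit) (by
    rintro _ (⟨i, j, h, rfl⟩ | ⟨i, j, h, rfl⟩)
    · simp only [map_mul, map_inv, FreeGroup.lift_apply_of, mul_inv_eq_one]
      ext
      simp only [Units.val_mul, val_fracUnit, ← map_mul]
      rw [gen_far (.inl h)]
    · simp only [map_mul, map_inv, FreeGroup.lift_apply_of, mul_inv_eq_one]
      ext
      simp only [Units.val_mul, val_fracUnit, ← map_mul]
      rw [mul_assoc, gen_adjacent (.inl h), mul_assoc])

theorem braidToFrac_positiveBraidHom {n : ℕ} (x : PosBraid (n - 1)) :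
    (braidToFrac n (positiveBraidHom n x) : Frac (n - 1)) = toFrac _ x := by
  induction x using gen_induction with
  | one => simp
  | gen_mul i y ih =>
    have : (braidToFrac n (braidGen n i) : Frac (n - 1)) = toFrac _ (gen i) := by
      rw [← val_fracUnit]
      exact congrArg Units.val (PresentedGroup.toGroup.of _)
    simp only [map_mul, Units.val_mul, ih, positiveBraidHom_gen, this]

/-- Garside's embedding theorem. -/
theorem positiveBraidHom_injective (n : ℕ) : Function.Injective (positiveBraidHom n) :=
  fun x y h => toFrac_injective (by
    rw [← braidToFrac_positiveBraidHom, h, braidToFrac_positiveBraidHom])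

theorem positiveBraidHom_fullTwist_commute {n : ℕ} (q : BraidGroup n) :
    Commute (positiveBraidHom n (fullTwist _)) q := by
  have : q ∈ Subgroup.centralizer {positiveBraidHom n (fullTwist _)} :=
    PresentedGroup.generated_by _ _ (fun i => Subgroup.mem_centralizer_singleton_iff.2
      (((fullTwist_commute_gen i).map (positiveBraidHom n)).symm.eq)) q
  exact (Subgroup.mem_centralizer_singleton_iff.1 this).symm

/-- Every braid becomes positive after multiplication with a power of the full twist. -/
theorem exists_mul_fullTwist_pow_eq {n : ℕ} (q : BraidGroup n) :
    ∃ (r : ℕ) (p : PosBraid (n - 1)),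
      q * positiveBraidHom n (fullTwist _) ^ r = positiveBraidHom n p := by
  have hmul {q q' : BraidGroup n}
      (h : ∃ (r : ℕ) (p : PosBraid (n - 1)),
        q * positiveBraidHom n (fullTwist _) ^ r = positiveBraidHom n p)
      (h' : ∃ (r : ℕ) (p : PosBraid (n - 1)),
        q' * positiveBraidHom n (fullTwist _) ^ r = positiveBraidHom n p) :
      ∃ (r : ℕ) (p : PosBraid (n - 1)),
        q * q' * positiveBraidHom n (fullTwist _) ^ r = positiveBraidHom n p := by
    obtain ⟨r, p, h⟩ := h
    obtain ⟨r', p', h'⟩ := h'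
    refine ⟨r + r', p * p', ?_⟩
    rw [map_mul, ← h, ← h', pow_add, mul_assoc, mul_assoc, ← mul_assoc q',
      ← ((positiveBraidHom_fullTwist_commute q').pow_left r).eq, mul_assoc]
  have hq : q ∈ Subgroup.closure (Set.range (PresentedGroup.of (rels := braidRels n))) := by
    rw [PresentedGroup.closure_range_of]; trivial
  induction hq using Subgroup.closure_induction'' with
  | mem x hx =>
    obtain ⟨i, rfl⟩ := hx
    exact ⟨0, gen i, by rw [pow_zero, mul_one]; rfl⟩
  | inv_mem x hx =>
    obtain ⟨i, rfl⟩ := hx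
    obtain ⟨y, hy, -⟩ := exists_complement i
    refine ⟨1, y, ?_⟩
    rw [← hy, pow_one, map_mul, ← mul_assoc]
    exact (congrArg (· * _) (inv_mul_cancel (braidGen n i))).trans (one_mul _)
  | one => exact ⟨0, 1, by simp⟩
  | mul x y _ _ hx hy => exact hmul hx hy

/-! ### Uniqueness of roots of half-twists. -/

/-- A braid that commutes with a positive power of a generator commutes with the generator. -/
theorem braidGen_commute_of_pow {n m : ℕ} (hm : 1 ≤ m) (i : Fin (n - 1)) {q : BraidGroup n}
    (h : Commute (braidGen n i ^ m) q) : Commute (braidGen n i) q := by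
  obtain ⟨r, p, hp⟩ := exists_mul_fullTwist_pow_eq q
  set z := positiveBraidHom n (fullTwist _) ^ r
  have hzc (x : BraidGroup n) : Commute x z :=
    ((positiveBraidHom_fullTwist_commute x).pow_left r).symm
  have h₁ : gen i ^ m * p = p * gen i ^ m := by
    apply positiveBraidHom_injective n
    simp only [map_mul, map_pow, positiveBraidHom_gen, ← hp]
    exact (h.mul_right (hzc _)).eq
  have h₂ : Commute (braidGen n i) (q * z) := by
    rw [hp, commute_iff_eq, ← positiveBraidHom_gen, ← map_mul, ← map_mul,
      gen_mul_eq_mul_gen_of_pow hm h₁]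
  simpa using h₂.mul_right (hzc _).inv_right

theorem halfTwist_eq_of_pow_eq {n : ℕ} (hn : 2 ≤ n) {H₁ H₂ : BraidGroup n}
    (h₁ : H₁ ∈ halfTwists n hn) (h₂ : H₂ ∈ halfTwists n hn) {m : ℕ} (hm : 1 ≤ m)
    (h : H₁ ^ m = H₂ ^ m) : H₁ = H₂ := by
  obtain ⟨q₁, rfl⟩ := h₁
  obtain ⟨q₂, rfl⟩ := h₂
  generalize hi : (⟨0, by omega⟩ : Fin (n - 1)) = i at *
  have conj_pow' (q s : BraidGroup n) : (q⁻¹ * s * q) ^ m = q⁻¹ * s ^ m * q := by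
    simpa using conj_pow (i := m) (a := q⁻¹) (b := s)
  rw [conj_pow', conj_pow'] at h
  have hc : Commute (braidGen n i ^ m) (q₁ * q₂⁻¹) := by
    rw [commute_iff_eq]
    calc _ = q₁ * (q₁⁻¹ * braidGen n i ^ m * q₁) * q₂⁻¹ := by group
      _ = _ := by rw [h]; group
  have h' := (braidGen_commute_of_pow hm i hc).eq
  calc _ = q₁⁻¹ * (braidGen n i * (q₁ * q₂⁻¹)) * q₂ := by group
    _ = _ := by rw [h']; group

/-! ### Non-unique square roots in `B_4`. -/

/-- The permutation of the strings of a braid on four strings. -/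
def braidPermFour : BraidGroup 4 →* Equiv.Perm (Fin 4) :=
  PresentedGroup.toGroup (f := fun i => Equiv.swap (Fin.castSucc i) (Fin.succ i)) (by
    rintro _ (⟨i, j, h, rfl⟩ | ⟨i, j, h, rfl⟩) <;>
    · simp only [map_mul, map_inv, FreeGroup.lift_apply_of, mul_inv_eq_one]
      revert i j
      decide)

/-- For `c = σ₁σ₂σ₃`, `c ^ 4` is the central full twist, so `c ^ 2` and its conjugate by `σ₁` have
equal squares; their permutations are different double transpositions. -/
theorem exists_sq_eq_sq_ne : ∃ a b : BraidGroup 4, a ^ 2 = b ^ 2 ∧ a ≠ b := by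
  set c : BraidGroup 4 := braidGen 4 0 * braidGen 4 1 * braidGen 4 2 with hc
  have hz : Commute (c ^ 4) (braidGen 4 0) := by
    have : positiveBraidHom 4 (fullTwist 3) = c ^ 4 := by
      simp [fullTwist, cox, natGen, hc]
      rfl
    exact this ▸ positiveBraidHom_fullTwist_commute _
  refine ⟨c ^ 2, braidGen 4 0 * c ^ 2 * (braidGen 4 0)⁻¹, ?_, fun h => ?_⟩
  · rw [conj_pow, ← pow_mul, ← hz.eq, mul_inv_cancel_right]
  · have hg (i : Fin 3) : braidPermFour (braidGen 4 i) = Equiv.swap i.castSucc i.succ :=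
      PresentedGroup.toGroup.of _
    replace h := congrArg braidPermFour h
    simp only [hc, map_mul, map_pow, map_inv] at h
    erw [hg, hg, hg] at h
    revert h
    decide

theorem theorem2p11 :
    (∀ (n : ℕ) (hn : 2 ≤ n) (H₁ H₂ : BraidGroup n),
      H₁ ∈ halfTwists n hn → H₂ ∈ halfTwists n hn →
        ∀ m : ℕ, 1 ≤ m → H₁ ^ m = H₂ ^ m → H₁ = H₂) ∧
    (∃ a b : BraidGroup 4, a ^ 2 = b ^ 2 ∧ a ≠ b) :=
  ⟨fun _ hn _ _ h₁ h₂ _ hm h => halfTwist_eq_of_pow_eq hn h₁ h₂ hm h, exists_sq_eq_sq_ne⟩
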